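/- Let $\mathbb K=\mathbb R$ or $\mathbb C$ and let $1\le p<\infty$. For a bounded sequence $w=(w_k)_{k\ge 1}$ of non-zero scalars, let $B_w:\ell^p\to\ell^p$ be the weighted shift $B_w(x_0,x_1,x_2,\dots)=(w_1x_1,w_2x_2,w_3x_3,\dots)$ on $\ell^p=\ell^p(\mathbb Z_{\ge 0},\mathbb K)$. For a continuous linear operator $T$ on a Banach space $X$, a vector $x\in X$ is *hypercyclic* for $T$ if $\{T^nx:n\ge 0\}$ is dense in $X$, and *frequently hypercyclic* for $T$ if for every non-empty open set $U\subset X$ $$\liminf_{N\to\infty}\frac{\#\{0\le n\le N:\ T^nx\in U\}}{N+1}>0 .$$ The operator $T$ is *frequently hypercyclic* if it has a frequently hypercyclic vector. A *hypercyclic subspace* (respectively, a *frequently hypercyclic subspace*) for $T$ is an infinite-dimensional closed subspace of $X$ in which every non-zero vector is hypercyclic (respectively, frequently hypercyclic) for $T$. **Theorem.** There exists a frequently hypercyclic weighted shift $B_w$ on $\ell^p$ that has a hypercyclic subspace but no frequently hypercyclic subspace. Explicitly, one may take $w_k=2$ if $1+n(n+1)\le k<1+(n+1)^2$ for some integer $n\ge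 0$, and $w_k=1$ for all other $k\ge 1$. -/

import Mathlib

open Filter Topology
open scoped ENNReal

namespace LinearDynamics

/-- The lower density `liminf_{N → ∞} #(A ∩ [0, N]) / (N + 1)` of a set of non-negative integers. -/
noncomputable def lowerDensity (A : Set ℕ) : ℝ :=
  liminf (fun N : ℕ => ((A ∩ Set.Iic N).ncard : ℝ) / ((N : ℝ) + 1)) atTop

section Operators

variable {𝕜 X : Type*} [RCLike 𝕜] [NormedAddCommGroup X] [NormedSpace 𝕜 X]

/-- `x` is a hypercyclic vector for `T`: its orbit `{T ^ n x : n ≥ 0}` is dense. -/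
def IsHypercyclicVector (T : X →L[𝕜] X) (x : X) : Prop :=
  Dense (Set.range fun n : ℕ => (T ^ n) x)

/-- `x` is a frequently hypercyclic vector for `T`: its orbit visits every non-empty open set
along a set of times of positive lower density. -/
def IsFrequentlyHypercyclicVector (T : X →L[𝕜] X) (x : X) : Prop :=
  ∀ U : Set X, IsOpen U → U.Nonempty → 0 < lowerDensity {n : ℕ | (T ^ n) x ∈ U}

/-- `T` has a frequently hypercyclic vector. -/
def IsFrequentlyHypercyclic (T : X →L[𝕜] X) : Prop :=
  ∃ x : X, IsFrequentlyHypercyclicVector T x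

/-- There is an infinite-dimensional closed subspace all of whose non-zero vectors are
hypercyclic for `T`. -/
def HasHypercyclicSubspace (T : X →L[𝕜] X) : Prop :=
  ∃ M : Submodule 𝕜 X, IsClosed (M : Set X) ∧ ¬ FiniteDimensional 𝕜 M ∧
    ∀ x ∈ M, x ≠ 0 → IsHypercyclicVector T x

/-- There is an infinite-dimensional closed subspace all of whose non-zero vectors are
frequently hypercyclic for `T`. -/
def HasFrequentlyHypercyclicSubspace (T : X →L[𝕜] X) : Prop :=
  ∃ M : Submodule 𝕜 X, IsClosed (M : Set X) ∧ ¬ FiniteDimensional 𝕜 M ∧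
    ∀ x ∈ M, x ≠ 0 → IsFrequentlyHypercyclicVector T x

end Operators

section Shift

variable {𝕜 : Type*} [RCLike 𝕜]

/-- `(w k)_{k ≥ 1}` is a bounded sequence of non-zero scalars (the value `w 0` plays no role). -/
structure IsWeightSequence (w : ℕ → 𝕜) : Prop where
  ne_zero : ∀ k, 1 ≤ k → w k ≠ 0
  bounded : ∃ C : ℝ, ∀ k, 1 ≤ k → ‖w k‖ ≤ C

theorem weightedShift_memlp {p : ℝ≥0∞} [Fact (1 ≤ p)] {w : ℕ → 𝕜} (hw : IsWeightSequence w)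
    (x : lp (fun _ : ℕ => 𝕜) p) :
    Memℓp (fun k : ℕ => w (k + 1) * x (k + 1)) p := by
  obtain ⟨C, hC⟩ := hw.bounded
  have hp1 : 1 ≤ p := Fact.out
  rcases p.trichotomy with rfl | rfl | hp
  · simp at hp1
  · obtain ⟨D, hD⟩ := (lp.memℓp x).bddAbove
    refine memℓp_infty ⟨C * D, ?_⟩
    rintro _ ⟨k, rfl⟩
    simp only [norm_mul]
    exact mul_le_mul (hC _ (by omega)) (hD ⟨k + 1, rfl⟩) (norm_nonneg _)
      ((norm_nonneg _).trans (hC 1 le_rfl))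
  · have hs : Summable fun k : ℕ => ‖x (k + 1)‖ ^ p.toReal :=
      (summable_nat_add_iff 1).2 ((lp.memℓp x).summable hp)
    refine memℓp_gen (Summable.of_nonneg_of_le (fun k => by positivity) (fun k => ?_)
      (hs.mul_left (C ^ p.toReal)))
    rw [norm_mul, Real.mul_rpow (norm_nonneg _) (norm_nonneg _)]
    have := hC (k + 1) (by omega)
    gcongr

theorem weightedShift_bound {p : ℝ≥0∞} [Fact (1 ≤ p)] {w : ℕ → 𝕜} (hw : IsWeightSequence w) :
    ∃ C : ℝ, ∀ x : lp (fun _ : ℕ => 𝕜) p,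
      ‖(⟨fun k : ℕ => w (k + 1) * x (k + 1), weightedShift_memlp hw x⟩ :
        lp (fun _ : ℕ => 𝕜) p)‖ ≤ C * ‖x‖ := by
  obtain ⟨C, hC⟩ := hw.bounded
  have hC0 : 0 ≤ C := (norm_nonneg _).trans (hC 1 le_rfl)
  have hp1 : 1 ≤ p := Fact.out
  refine ⟨C, fun x => ?_⟩
  rcases p.trichotomy with rfl | rfl | hp
  · simp at hp1
  · refine lp.norm_le_of_forall_le (by positivity) fun k => ?_
    change ‖w (k + 1) * x (k + 1)‖ ≤ _
    rw [norm_mul]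
    exact mul_le_mul (hC _ (by omega)) (lp.norm_apply_le_norm (by simp) x (k + 1))
      (norm_nonneg _) hC0
  · refine lp.norm_le_of_forall_sum_le hp (by positivity) fun s => ?_
    calc ∑ k ∈ s, ‖w (k + 1) * x (k + 1)‖ ^ p.toReal
        ≤ ∑ k ∈ s, C ^ p.toReal * ‖x (k + 1)‖ ^ p.toReal := by
          refine Finset.sum_le_sum fun k _ => ?_
          rw [norm_mul, Real.mul_rpow (norm_nonneg _) (norm_nonneg _)]
          have := hC (k + 1) (by omega)
          gcongr
      _ = C ^ p.toReal * ∑ j ∈ s.map (addRightEmbedding 1), ‖x j‖ ^ p.toReal := by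
          rw [Finset.sum_map, Finset.mul_sum]
          rfl
      _ ≤ C ^ p.toReal * ‖x‖ ^ p.toReal := by
          gcongr
          exact lp.sum_rpow_le_norm_rpow hp x _
      _ = (C * ‖x‖) ^ p.toReal := (Real.mul_rpow hC0 (norm_nonneg _)).symm

/-- The weighted backward shift `B_w (x_0, x_1, x_2, …) = (w_1 x_1, w_2 x_2, w_3 x_3, …)`
as a continuous linear operator on `ℓ^p(ℕ, 𝕜)`. -/
noncomputable def weightedShift (p : ℝ≥0∞) [Fact (1 ≤ p)] (w : ℕ → 𝕜)
    (hw : IsWeightSequence w) :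
    lp (fun _ : ℕ => 𝕜) p →L[𝕜] lp (fun _ : ℕ => 𝕜) p :=
  LinearMap.mkContinuousOfExistsBound
    { toFun := fun x => ⟨fun k : ℕ => w (k + 1) * x (k + 1), weightedShift_memlp hw x⟩
      map_add' := fun x y => by
        ext k
        exact mul_add _ _ _
      map_smul' := fun c x => by
        ext k
        exact mul_left_comm _ _ _ }
    (weightedShift_bound hw)

theorem weightedShift_apply (p : ℝ≥0∞) [Fact (1 ≤ p)] (w : ℕ → 𝕜) (hw : IsWeightSequence w)
    (x : lp (fun _ : ℕ => 𝕜) p) (k : ℕ) :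
    weightedShift p w hw x k = w (k + 1) * x (k + 1) := rfl

end Shift

end LinearDynamics

/-! Write D(k) for the number of weights 2 among w_1, …, w_k (`doublings`). In the coordinates
2^D(k) x_k the operator is the unweighted shift (`two_pow_mul_blockShift_pow_apply`), and k ≤ 2 D(k)
≤ k + √k + 1. So growth is geometric up to a factor 2^O(√k), yet there are arbitrarily long runs of
weights equal to 1. Each half of the theorem uses one of these features.

Frequent hypercyclicity: finite words are concatenated so that each recurs with bounded gaps.
Letters met at offset k have size at most k, and ∑ k 2^(-k/2) converges, so whatever follows a word
is negligible (`norm_blockShift_pow_sub_wordVec_le`).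

Hypercyclic subspace: basis vectors sitting at the ends of long runs of 1 are perturbed by words.
Until the matching word has been read, later basis vectors move without being amplified
(`norm_blockShift_pow_pivotPart_le`), so tails of an ℓ^p combination stay small.

No frequently hypercyclic subspace: by Baire, a closed infinite-dimensional subspace contains x with
|x_m| > (m+1)^(-2) for infinitely many m (`exists_frequently_lt_norm_apply`). For such m, the growth
of D forces the orbit out of the unit ball at all times from 9(√m + 1) to m
(`one_le_norm_blockShift_pow`), so its visits there have lower density zero. -/

namespace LinearDynamics

/-! ### Counting the doublings in the block weight. -/

section BlockWeight

/-- The positions at which the block weight takes the value `2`. -/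
def IsDoubling (k : ℕ) : Prop := ∃ n : ℕ, 1 + n * (n + 1) ≤ k ∧ k < 1 + (n + 1) ^ 2

/-- Block r consists of the 2(r + 1) positions following r(r + 1): first r + 1 twos, then r + 1
ones. -/
theorem isDoubling_iff {r t : ℕ} (h1 : 1 ≤ t) (h2 : t ≤ 2 * (r + 1)) :
    IsDoubling (r * (r + 1) + t) ↔ t ≤ r + 1 := by
  constructor
  · rintro ⟨n, hn1, hn2⟩
    by_contra! h
    rcases le_or_gt n r with hnr | hnr
    · nlinarith
    · have : n * (n + 1) ≥ (r + 1) * (r + 2) := Nat.mul_le_mul hnr (by omega)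
      nlinarith
  · intro h
    exact ⟨r, by omega, by nlinarith⟩

open Classical in
/-- The number of doubling positions in `[1, k]`. -/
noncomputable def doublings : ℕ → ℕ
  | 0 => 0
  | k + 1 => doublings k + if IsDoubling (k + 1) then 1 else 0

theorem exists_block (k : ℕ) : ∃ r t, t < 2 * (r + 1) ∧ k = r * (r + 1) + t := by
  induction k with
  | zero => exact ⟨0, 0, by simp⟩
  | succ k ih =>
    obtain ⟨r, t, ht, rfl⟩ := ih
    by_cases h : t + 1 < 2 * (r + 1)
    · exact ⟨r, t + 1, h, by ring⟩
    · refine ⟨r + 1, 0, by omega, ?_⟩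
      obtain rfl : t = 2 * r + 1 := by omega
      ring

/-- The excess of 2 D(k) over k is a tent on each block: it rises by 1 on the twos, falls by 1 on
the ones, and is back to 0 at the end, which starts the next block. -/
theorem two_mul_doublings (r : ℕ) : ∀ t ≤ 2 * (r + 1),
    2 * doublings (r * (r + 1) + t) = r * (r + 1) + t + min t (2 * (r + 1) - t) := by
  have step : ∀ r, 2 * doublings (r * (r + 1)) = r * (r + 1) → ∀ t ≤ 2 * (r + 1),
      2 * doublings (r * (r + 1) + t) = r * (r + 1) + t + min t (2 * (r + 1) - t) := by
    intro r h0 t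
    induction t with
    | zero => intro _; simpa using h0
    | succ t ih =>
      intro ht
      have h1 := ih (by omega)
      have h2 := isDoubling_iff (r := r) (t := t + 1) (by omega) ht
      rw [← add_assoc, doublings, add_assoc _ t 1]
      by_cases h : t + 1 ≤ r + 1
      · rw [if_pos (h2.2 h)]; omega
      · rw [if_neg (fun h' => h (h2.1 h'))]; omega
  refine step r ?_
  induction r with
  | zero => simp [doublings]
  | succ r ih =>
    have := step r ih (2 * (r + 1)) le_rfl
    rw [show (r + 1) * (r + 1 + 1) = r * (r + 1) + 2 * (r + 1) by ring]
    simpa using this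

theorem le_two_mul_doublings (k : ℕ) : k ≤ 2 * doublings k := by
  obtain ⟨r, t, ht, rfl⟩ := exists_block k
  rw [two_mul_doublings r t ht.le]
  omega

theorem two_mul_doublings_le (k : ℕ) : 2 * doublings k ≤ k + Nat.sqrt k + 1 := by
  obtain ⟨r, t, ht, rfl⟩ := exists_block k
  rw [two_mul_doublings r t ht.le]
  have : r ≤ Nat.sqrt (r * (r + 1) + t) := Nat.le_sqrt.2 (by nlinarith)
  omega

/-- The weight is `1` on the `R` positions up to `R (R + 1)`. -/
theorem doublings_eq_of_le {R q : ℕ} (hq : q ≤ R) :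
    doublings (R * (R + 1) - q) = doublings (R * (R + 1)) := by
  rcases R with _ | r
  · simp
  · have h1 := two_mul_doublings r (2 * (r + 1) - q) (by omega)
    have h2 := two_mul_doublings r (2 * (r + 1)) le_rfl
    rw [show (r + 1) * (r + 1 + 1) = r * (r + 1) + 2 * (r + 1) by ring,
      show r * (r + 1) + 2 * (r + 1) - q = r * (r + 1) + (2 * (r + 1) - q) by omega]
    omega

/-- `1 / √2`, the decay rate of the reciprocal weight products. -/
noncomputable def decay : ℝ := (√2)⁻¹

theorem decay_pos : 0 < decay := by unfold decay; positivity

theorem decay_lt_one : decay < 1 :=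
  inv_lt_one_of_one_lt₀ (Real.lt_sqrt_of_sq_lt (by norm_num))

theorem inv_two_pow_doublings_le (k : ℕ) : ((2 : ℝ) ^ doublings k)⁻¹ ≤ decay ^ k := by
  have h : (2 : ℝ) ^ doublings k = √2 ^ (2 * doublings k) := by
    rw [pow_mul, Real.sq_sqrt (by norm_num)]
  rw [decay, inv_pow, h]
  exact inv_anti₀ (by positivity)
    (pow_le_pow_right₀ (Real.one_le_sqrt.2 (by norm_num)) (le_two_mul_doublings k))

theorem summable_mul_decay_pow : Summable fun k : ℕ => (k : ℝ) * decay ^ k := by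
  simpa using summable_pow_mul_geometric_of_norm_lt_one (R := ℝ) 1 (r := decay)
    (by rw [Real.norm_of_nonneg decay_pos.le]; exact decay_lt_one)

open Classical in
/-- The weight taking the value `2` at doubling positions and `1` elsewhere. -/
noncomputable def blockWeight (𝕜 : Type*) [RCLike 𝕜] (k : ℕ) : 𝕜 := if IsDoubling k then 2 else 1

variable {𝕜 : Type*} [RCLike 𝕜]

theorem isWeightSequence_blockWeight : IsWeightSequence (blockWeight 𝕜) where
  ne_zero k _ := by unfold blockWeight; split_ifs <;> norm_num
  bounded := ⟨2, fun k _ => by unfold blockWeight; split_ifs <;> norm_num⟩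

theorem two_pow_doublings_succ (k : ℕ) :
    (2 : 𝕜) ^ doublings k * blockWeight 𝕜 (k + 1) = 2 ^ doublings (k + 1) := by
  rw [doublings, blockWeight]
  split_ifs <;> simp [pow_succ]

end BlockWeight

/-! ### Norm estimates in ℓ^p and iterates of the shift. -/

section Sequences

variable {𝕜 : Type*} [RCLike 𝕜] {p : ℝ≥0∞}

/-- The part of a sequence supported on `[N, ∞)`. -/
noncomputable def tailPart (f : lp (fun _ : ℕ => 𝕜) p) (N : ℕ) : lp (fun _ : ℕ => 𝕜) p :=
  f - ∑ k ∈ Finset.range N, lp.single p k (f k)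

theorem sum_single_apply (g : ℕ → 𝕜) (N k : ℕ) :
    (∑ i ∈ Finset.range N, lp.single (E := fun _ : ℕ => 𝕜) p i (g i)) k =
      if k < N then g k else 0 := by
  rw [lp.coeFn_sum, Finset.sum_apply]
  simp [Pi.single_apply, lp.single_apply]

theorem tailPart_apply (f : lp (fun _ : ℕ => 𝕜) p) (N k : ℕ) :
    tailPart f N k = if k < N then 0 else f k := by
  rw [tailPart, lp.coeFn_sub, Pi.sub_apply, sum_single_apply]
  split_ifs <;> simp

variable [Fact (1 ≤ p)]

theorem memℓp_of_norm_le_summable {f : ℕ → 𝕜} {g : ℕ → ℝ} (hg : Summable g)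
    (h : ∀ k, ‖f k‖ ≤ g k) : Memℓp f p := by
  refine Memℓp.of_exponent_ge (q := 1) (memℓp_gen ?_) Fact.out
  simpa using Summable.of_nonneg_of_le (fun k => norm_nonneg (f k)) h hg

theorem norm_single_le (k : ℕ) (a : 𝕜) :
    ‖lp.single (E := fun _ : ℕ => 𝕜) p k a‖ = ‖a‖ :=
  lp.norm_single (E := fun _ : ℕ => 𝕜) (zero_lt_one.trans_le (Fact.out : 1 ≤ p)) k a

/-- Canonical vectors have norm 1, so the ℓ^1 sum dominates; this treats all finite p at once. -/
theorem norm_le_tsum_of_norm_le (hp : p ≠ ∞) {f : lp (fun _ : ℕ => 𝕜) p} {g : ℕ → ℝ}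
    (hg : Summable g) (h : ∀ k, ‖f k‖ ≤ g k) : ‖f‖ ≤ ∑' k, g k :=
  (lp.hasSum_single hp f).norm_le_of_bounded hg.hasSum fun k => by
    rw [norm_single_le]; exact h k

theorem norm_apply_le (f : lp (fun _ : ℕ => 𝕜) p) (k : ℕ) : ‖f k‖ ≤ ‖f‖ :=
  lp.norm_apply_le_norm (zero_lt_one.trans_le Fact.out).ne' f k

theorem continuous_apply_lp (k : ℕ) : Continuous fun f : lp (fun _ : ℕ => 𝕜) p => f k :=
  (lp.lipschitzWith_one_eval p k).continuous

/-- A sequence dominated by a shift of another one has a smaller norm. -/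
theorem norm_le_of_norm_le_add (hp : p ≠ ∞) {f h : lp (fun _ : ℕ => 𝕜) p} (n : ℕ)
    (hfh : ∀ k, ‖f k‖ ≤ ‖h (k + n)‖) : ‖f‖ ≤ ‖h‖ := by
  have hp0 : 0 < p.toReal := ENNReal.toReal_pos (zero_lt_one.trans_le Fact.out).ne' hp
  refine lp.norm_le_of_forall_sum_le hp0 (norm_nonneg _) fun s => ?_
  calc ∑ k ∈ s, ‖f k‖ ^ p.toReal ≤ ∑ k ∈ s, ‖h (k + n)‖ ^ p.toReal := by
        gcongr with k _; exact hfh k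
    _ = ∑ j ∈ s.map (addRightEmbedding n), ‖h j‖ ^ p.toReal := by
        rw [Finset.sum_map]; rfl
    _ ≤ ‖h‖ ^ p.toReal := lp.sum_rpow_le_norm_rpow hp0 h _

theorem tendsto_tailPart (hp : p ≠ ∞) (f : lp (fun _ : ℕ => 𝕜) p) :
    Tendsto (fun N => ‖tailPart f N‖) atTop (𝓝 0) := by
  have h := (lp.hasSum_single hp f).tendsto_sum_nat
  have h2 := (tendsto_const_nhds (x := f)).sub h
  rw [sub_self] at h2
  simpa [tailPart] using h2.norm

/-- The shift with block weight. -/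
noncomputable abbrev blockShift (𝕜 : Type*) [RCLike 𝕜] (p : ℝ≥0∞) [Fact (1 ≤ p)] :
    lp (fun _ : ℕ => 𝕜) p →L[𝕜] lp (fun _ : ℕ => 𝕜) p :=
  weightedShift p (blockWeight 𝕜) isWeightSequence_blockWeight

/-- The diagonal map with entries 2^D(k) conjugates the operator to the unweighted shift. -/
theorem two_pow_mul_blockShift_pow_apply (x : lp (fun _ : ℕ => 𝕜) p) (n k : ℕ) :
    (2 : 𝕜) ^ doublings k * ((blockShift 𝕜 p ^ n) x) k =
      2 ^ doublings (k + n) * x (k + n) := by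
  induction n generalizing x with
  | zero => simp
  | succ n ih =>
    rw [pow_succ, mul_apply_eq_comp, ih, weightedShift_apply, ← mul_assoc,
      two_pow_doublings_succ]
    rfl

theorem norm_blockShift_pow_apply (x : lp (fun _ : ℕ => 𝕜) p) (n k : ℕ) :
    ‖((blockShift 𝕜 p ^ n) x) k‖ =
      ((2 : ℝ) ^ doublings k)⁻¹ * ‖(2 : 𝕜) ^ doublings (k + n) * x (k + n)‖ := by
  rw [← two_pow_mul_blockShift_pow_apply, norm_mul, norm_pow, RCLike.norm_ofNat,
    inv_mul_cancel_left₀ (by positivity)]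

end Sequences

/-! ### A countable dictionary of finite words, dense in ℓ^p. -/

section Words

variable {𝕜 : Type*} [RCLike 𝕜]

/-- A dense alphabet of scalars, with `0` as letter number `0`. -/
noncomputable def letter (𝕜 : Type*) [RCLike 𝕜] : ℕ → 𝕜
  | 0 => 0
  | n + 1 => TopologicalSpace.denseSeq 𝕜 n

theorem exists_letter_near (a : 𝕜) {ε : ℝ} (hε : 0 < ε) : ∃ d, ‖letter 𝕜 d - a‖ < ε := by
  obtain ⟨n, hn⟩ := (TopologicalSpace.denseRange_denseSeq 𝕜).exists_dist_lt a hε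
  exact ⟨n + 1, by rwa [dist_comm, dist_eq_norm] at hn⟩

/-- The tag of the `s`-th word. -/
def wordTag (s : ℕ) : ℕ := (Nat.unpair s).1

open Classical in
/-- The `k`-th letter of the `s`-th word; it vanishes for `k ≥ s` and has norm at most `s`. -/
noncomputable def word (𝕜 : Type*) [RCLike 𝕜] (s k : ℕ) : 𝕜 :=
  let a := letter 𝕜 ((Denumerable.ofNat (List ℕ) (Nat.unpair (Nat.unpair s).2).1).getD k 0)
  if k < s ∧ ‖a‖ ≤ s then a else 0

theorem norm_word_le (s k : ℕ) : ‖word 𝕜 s k‖ ≤ s := by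
  unfold word
  dsimp only
  split_ifs with h
  · exact h.2
  · simp

theorem word_eq_zero {s k : ℕ} (h : s ≤ k) : word 𝕜 s k = 0 := if_neg fun h' => by omega

variable {p : ℝ≥0∞}

/-- The vector of `ℓ^p` described by the `s`-th word. -/
noncomputable def wordVec (𝕜 : Type*) [RCLike 𝕜] (p : ℝ≥0∞) (s : ℕ) : lp (fun _ : ℕ => 𝕜) p :=
  ∑ k ∈ Finset.range s, lp.single p k (((2 : 𝕜) ^ doublings k)⁻¹ * word 𝕜 s k)

theorem wordVec_apply (s k : ℕ) :
    wordVec 𝕜 p s k = if k < s then ((2 : 𝕜) ^ doublings k)⁻¹ * word 𝕜 s k else 0 :=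
  sum_single_apply _ _ _

/-- The index s encodes a tag, a list of letters and a third number that is pure padding. The
padding makes s exceed S, the length K and the size of every letter, so the truncations in `word` do
nothing. -/
theorem exists_word_eq (i S K : ℕ) (d : ℕ → ℕ) :
    ∃ s ≥ S, wordTag s = i ∧ K ≤ s ∧
      ∀ k, word 𝕜 s k = if k < K then letter 𝕜 (d k) else 0 := by
  obtain ⟨j, hj⟩ := exists_nat_ge (∑ k ∈ Finset.range K, ‖letter 𝕜 (d k)‖)
  let l : List ℕ := (List.range K).map d
  let t := Nat.pair (Encodable.encode l) (j + K + S)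
  have ht : j + K + S ≤ Nat.pair i t := (Nat.right_le_pair _ _).trans (Nat.right_le_pair _ _)
  refine ⟨Nat.pair i t, by omega, by simp [wordTag], by omega, fun k => ?_⟩
  have hl : (Denumerable.ofNat (List ℕ) (Nat.unpair (Nat.unpair (Nat.pair i t)).2).1) = l := by
    simp [t]
  unfold word
  rw [hl]
  dsimp only
  by_cases hk : k < K
  · have hd : l.getD k 0 = d k := by simp [l, List.getD, hk]
    rw [hd, if_pos hk, if_pos]
    refine ⟨by omega, ?_⟩
    calc ‖letter 𝕜 (d k)‖ ≤ ∑ k ∈ Finset.range K, ‖letter 𝕜 (d k)‖ :=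
          Finset.single_le_sum (f := fun k => ‖letter 𝕜 (d k)‖) (fun _ _ => norm_nonneg _)
            (Finset.mem_range.2 hk)
      _ ≤ j := hj
      _ ≤ _ := by exact_mod_cast (show j ≤ Nat.pair i t by omega)
  · have hd : l.getD k 0 = 0 := by simp [l, List.getD, hk]
    rw [hd, if_neg hk]
    simp [letter]

variable [Fact (1 ≤ p)]

theorem exists_wordVec_near (hp : p ≠ ∞) (x : lp (fun _ : ℕ => 𝕜) p) {ε : ℝ} (hε : 0 < ε)
    (i S : ℕ) : ∃ s ≥ S, wordTag s = i ∧ ‖wordVec 𝕜 p s - x‖ < ε := by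
  obtain ⟨K, hK⟩ := ((tendsto_tailPart hp x).eventually_lt_const
    (show (0 : ℝ) < ε / 2 by positivity)).exists
  -- K letters with this error cost at most ε/2 in total; K + 1 avoids dividing by zero when K = 0.
  have hδ : 0 < ε / (2 * (K + 1)) := by positivity
  choose d hd using fun k => exists_letter_near ((2 : 𝕜) ^ doublings k * x k) hδ
  obtain ⟨s, hsS, hsi, hKs, hs⟩ := exists_word_eq (𝕜 := 𝕜) i S K d
  refine ⟨s, hsS, hsi, ?_⟩
  have hsplit : wordVec 𝕜 p s - x = (∑ k ∈ Finset.range K, lp.single p k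
      (((2 : 𝕜) ^ doublings k)⁻¹ * (letter 𝕜 (d k) - 2 ^ doublings k * x k))) -
        tailPart x K := by
    ext k
    rw [lp.coeFn_sub, lp.coeFn_sub, Pi.sub_apply, Pi.sub_apply, wordVec_apply, sum_single_apply,
      tailPart_apply, hs]
    by_cases hk : k < K
    · have : (2 : 𝕜) ^ doublings k ≠ 0 := pow_ne_zero _ two_ne_zero
      simp only [hk, if_true, hk.trans_le hKs]
      field_simp
      ring
    · simp [hk]
  have hsum : ‖∑ k ∈ Finset.range K, lp.single (E := fun _ : ℕ => 𝕜) p k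
      (((2 : 𝕜) ^ doublings k)⁻¹ * (letter 𝕜 (d k) - 2 ^ doublings k * x k))‖ ≤
        K * (ε / (2 * (K + 1))) := by
    refine (norm_sum_le_of_le _ (f := fun k => lp.single (E := fun _ : ℕ => 𝕜) p k
      (((2 : 𝕜) ^ doublings k)⁻¹ * (letter 𝕜 (d k) - 2 ^ doublings k * x k)))
      (n := fun _ => ε / (2 * (K + 1))) fun k _ => ?_).trans_eq (by simp)
    rw [norm_single_le, norm_mul, norm_inv, norm_pow, RCLike.norm_ofNat]
    have h1 : ((2 : ℝ) ^ doublings k)⁻¹ ≤ 1 := inv_le_one_of_one_le₀ (one_le_pow₀ (by norm_num))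
    calc _ ≤ 1 * ‖letter 𝕜 (d k) - 2 ^ doublings k * x k‖ := by gcongr
      _ ≤ _ := by rw [one_mul]; exact (hd k).le
  have hlt : K * (ε / (2 * (K + 1))) ≤ ε / 2 := by
    rw [mul_div_assoc', div_le_div_iff₀ (by positivity) (by positivity)]
    nlinarith
  rw [hsplit]
  linarith [norm_sub_le (∑ k ∈ Finset.range K, lp.single (E := fun _ : ℕ => 𝕜) p k
      (((2 : 𝕜) ^ doublings k)⁻¹ * (letter 𝕜 (d k) - 2 ^ doublings k * x k))) (tailPart x K)]

/-- The tails of the series `∑ k * decay ^ k`. -/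
noncomputable def decayTail (s : ℕ) : ℝ := ∑' k : ℕ, ((k + s : ℕ) : ℝ) * decay ^ (k + s)

theorem tendsto_decayTail : Tendsto decayTail atTop (𝓝 0) :=
  tendsto_sum_nat_add fun k : ℕ => (k : ℝ) * decay ^ k

/-- The iterate of the shift at a time where a multiple of a word starts is close to that multiple
of the corresponding vector. -/
theorem norm_blockShift_pow_sub_wordVec_le (hp : p ≠ ∞) {x : lp (fun _ : ℕ => 𝕜) p} {n s : ℕ}
    {c : 𝕜} {C : ℝ} (h1 : ∀ k < s, (2 : 𝕜) ^ doublings (k + n) * x (k + n) = c * word 𝕜 s k)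
    (h2 : ∀ k ≥ s, ‖(2 : 𝕜) ^ doublings (k + n) * x (k + n)‖ ≤ C * k) :
    ‖(blockShift 𝕜 p ^ n) x - c • wordVec 𝕜 p s‖ ≤ C * decayTail s := by
  -- Below s the coordinates agree exactly; from s on the word vector vanishes and the decay
  -- 2^(-D(k)) beats the linear bound.
  have hb : ∀ k, ‖((blockShift 𝕜 p ^ n) x - c • wordVec 𝕜 p s) k‖ ≤
      if k < s then 0 else C * (k * decay ^ k) := by
    intro k
    have happ : ((blockShift 𝕜 p ^ n) x - c • wordVec 𝕜 p s) k =
      ((blockShift 𝕜 p ^ n) x) k - c * wordVec 𝕜 p s k := rfl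
    rw [happ, wordVec_apply]
    split_ifs with hk
    · have h0 : (2 : 𝕜) ^ doublings k ≠ 0 := pow_ne_zero _ two_ne_zero
      have := h1 k hk
      rw [← two_pow_mul_blockShift_pow_apply] at this
      rw [norm_le_zero_iff, sub_eq_zero, eq_comm, mul_left_comm, ← this, inv_mul_cancel_left₀ h0]
    · rw [mul_zero, sub_zero, norm_blockShift_pow_apply]
      have h3 := h2 k (by omega)
      calc _ ≤ decay ^ k * (C * k) := by
            gcongr
            · exact pow_nonneg decay_pos.le _
            · exact inv_two_pow_doublings_le k
        _ = _ := by ring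
  have hs : HasSum (fun k : ℕ => if k < s then 0 else C * (k * decay ^ k)) (C * decayTail s) := by
    rw [← hasSum_nat_add_iff' s]
    have h0 : ∑ i ∈ Finset.range s, (if i < s then 0 else C * ((i : ℝ) * decay ^ i)) = 0 :=
      Finset.sum_eq_zero fun i hi => if_pos (Finset.mem_range.1 hi)
    rw [h0, sub_zero]
    simpa [decayTail] using ((summable_nat_add_iff s).2 summable_mul_decay_pow).hasSum.mul_left C
  rw [← hs.tsum_eq]
  exact norm_le_tsum_of_norm_le hp hs.summable hb

theorem inv_two_pow_mul_memℓp {z : ℕ → 𝕜} {C : ℝ} (hz : ∀ k, ‖z k‖ ≤ C * k) :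
    Memℓp (fun k => ((2 : 𝕜) ^ doublings k)⁻¹ * z k) p := by
  refine memℓp_of_norm_le_summable (summable_mul_decay_pow.mul_left C) fun k => ?_
  rw [norm_mul, norm_inv, norm_pow, RCLike.norm_ofNat]
  calc _ ≤ decay ^ k * (C * k) := by
        gcongr
        · exact pow_nonneg decay_pos.le _
        · exact inv_two_pow_doublings_le k
        · exact hz k
    _ = _ := by ring

end Words

/-! ### Absence of a frequently hypercyclic subspace. -/

section NoFrequentlyHypercyclicSubspace

variable {𝕜 : Type*} [RCLike 𝕜] {p : ℝ≥0∞} [Fact (1 ≤ p)]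

/-- An infinite-dimensional space of sequences contains non-zero sequences vanishing on any given
initial segment. -/
theorem exists_norm_eq_one_forall_lt (M : Submodule 𝕜 (lp (fun _ : ℕ => 𝕜) p))
    (hM : ¬ FiniteDimensional 𝕜 M) (N : ℕ) :
    ∃ u ∈ M, ‖u‖ = 1 ∧ ∀ k < N, u k = 0 := by
  let L : M →ₗ[𝕜] (Fin N → 𝕜) :=
    { toFun := fun x i => (x : lp (fun _ : ℕ => 𝕜) p) i
      map_add' := fun x y => rfl
      map_smul' := fun c x => rfl }
  have hL : ¬ Function.Injective L := fun h => hM (FiniteDimensional.of_injective L h)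
  rw [← LinearMap.ker_eq_bot, Submodule.eq_bot_iff] at hL
  push Not at hL
  obtain ⟨x, hx, hx0⟩ := hL
  have hx0' : ‖x‖ ≠ 0 := norm_ne_zero_iff.2 hx0
  refine ⟨((‖x‖ : 𝕜)⁻¹ • x : M), Subtype.coe_prop _, ?_, fun k hk => ?_⟩
  · change ‖(‖x‖ : 𝕜)⁻¹ • x‖ = 1
    rw [norm_smul, norm_inv, RCLike.norm_ofReal, abs_norm, inv_mul_cancel₀ hx0']
  · have : (x : lp (fun _ : ℕ => 𝕜) p) k = 0 := congrFun (LinearMap.mem_ker.1 hx) ⟨k, hk⟩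
    change (‖x‖ : 𝕜)⁻¹ • (x : lp (fun _ : ℕ => 𝕜) p) k = 0
    rw [this, smul_zero]

/-- A closed infinite-dimensional subspace of `ℓ^p` contains a vector which infinitely often
exceeds a given summable sequence. -/
theorem exists_frequently_lt_norm_apply (hp : p ≠ ∞) (M : Submodule 𝕜 (lp (fun _ : ℕ => 𝕜) p))
    (hMc : IsClosed (M : Set (lp (fun _ : ℕ => 𝕜) p))) (hM : ¬ FiniteDimensional 𝕜 M)
    {a : ℕ → ℝ} (ha : Summable a) :
    ∃ x ∈ M, ∃ᶠ m in atTop, a m < ‖x m‖ := by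
  have : CompleteSpace M := hMc.completeSpace_coe
  -- Baire category in the complete space M: the intersection of these open dense sets is the set of
  -- vectors sought.
  let G : ℕ → Set M := fun N => {x | ∃ m ≥ N, a m < ‖(x : lp (fun _ : ℕ => 𝕜) p) m‖}
  have hopen : ∀ N, IsOpen (G N) := fun N => by
    have : G N = ⋃ m ≥ N, {x : M | a m < ‖(x : lp (fun _ : ℕ => 𝕜) p) m‖} := by
      ext x; simp [G]
    rw [this]
    refine isOpen_iUnion fun m => isOpen_iUnion fun _ => ?_
    exact isOpen_lt continuous_const ((continuous_apply_lp m).comp continuous_subtype_val).norm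
  have hdense : ∀ N, Dense (G N) := fun N => by
    rw [Metric.dense_iff]
    intro y ε hε
    have htail := tendsto_sum_nat_add a
    obtain ⟨K, hK, hNK⟩ := ((htail.eventually_lt_const (show (0 : ℝ) < ε / 4 by positivity)).and
      (eventually_ge_atTop N)).exists
    by_cases hy : y ∈ G N
    · exact ⟨y, Metric.mem_ball_self hε, hy⟩
    obtain ⟨u, huM, hu1, hu0⟩ := exists_norm_eq_one_forall_lt M hM K
    have hε2 : ‖(((ε / 2 : ℝ) : 𝕜))‖ = ε / 2 := by
      rw [RCLike.norm_ofReal, abs_of_pos (by positivity)]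
    refine ⟨y + (((ε / 2 : ℝ) : 𝕜)) • ⟨u, huM⟩, ?_, ?_⟩
    · rw [Metric.mem_ball, dist_eq_norm, add_sub_cancel_left, norm_smul, hε2]
      change ε / 2 * ‖u‖ < ε
      rw [hu1]; linarith
    · by_contra hcon
      simp only [G, Set.mem_ofPred_eq, not_exists, not_and, not_lt] at hy hcon
      -- If y and its perturbation both missed `G N`, their difference, of norm ε/2, would be
      -- dominated by twice the tail of `a` beyond K, which is less than ε/2.
      have hb : ∀ k, ‖((((ε / 2 : ℝ) : 𝕜)) • u) k‖ ≤ if k < K then 0 else 2 * a k := by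
        intro k
        have happ : ((((ε / 2 : ℝ) : 𝕜)) • u) k = (((ε / 2 : ℝ) : 𝕜)) * u k := rfl
        split_ifs with hk
        · rw [happ, hu0 k hk, mul_zero, norm_zero]
        · have h1 := hy k (by omega)
          have h2 := hcon k (by omega)
          have h3 : ((((ε / 2 : ℝ) : 𝕜)) • u) k =
              ((y + (((ε / 2 : ℝ) : 𝕜)) • ⟨u, huM⟩ : M) : lp (fun _ : ℕ => 𝕜) p) k -
                (y : lp (fun _ : ℕ => 𝕜) p) k := (add_sub_cancel_left _ _).symm
          rw [h3]
          linarith [norm_sub_le (((y + (((ε / 2 : ℝ) : 𝕜)) • ⟨u, huM⟩ : M) :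
            lp (fun _ : ℕ => 𝕜) p) k) ((y : lp (fun _ : ℕ => 𝕜) p) k)]
      have hs : HasSum (fun k => if k < K then 0 else 2 * a k) (2 * ∑' k, a (k + K)) := by
        rw [← hasSum_nat_add_iff' K]
        have h0 : ∑ i ∈ Finset.range K, (if i < K then 0 else 2 * a i) = 0 :=
          Finset.sum_eq_zero fun i hi => if_pos (Finset.mem_range.1 hi)
        rw [h0, sub_zero]
        simpa using (((summable_nat_add_iff K).2 ha).hasSum.mul_left 2)
      have := norm_le_tsum_of_norm_le hp hs.summable hb
      rw [hs.tsum_eq, norm_smul, hε2, hu1] at this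
      linarith
  obtain ⟨x, hx⟩ := (dense_iInter_of_isOpen_nat hopen hdense).nonempty
  refine ⟨x, x.2, frequently_atTop.2 fun N => ?_⟩
  exact Set.mem_iInter.1 hx N

/-- If `A` has few elements below `m` for infinitely many `m` then `A` has lower density zero. -/
theorem lowerDensity_nonpos_of_frequently {A : Set ℕ}
    (h : ∃ᶠ m in atTop, ∀ n ∈ A, n ≤ m → n < 9 * (Nat.sqrt m + 1)) : lowerDensity A ≤ 0 := by
  refine le_of_forall_pos_le_add fun δ hδ => ?_
  rw [zero_add]
  have hbdd : IsBoundedUnder (· ≥ ·) atTop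
      fun N : ℕ => ((A ∩ Set.Iic N).ncard : ℝ) / ((N : ℝ) + 1) :=
    isBoundedUnder_of ⟨0, fun N => by positivity⟩
  refine liminf_le_of_frequently_le ?_ hbdd
  -- With √m ≥ R, one has 9(√m + 1) ≤ 18 √m ≤ δ m.
  obtain ⟨R, hR⟩ := exists_nat_gt (18 / δ + 1)
  refine (h.and_eventually (eventually_ge_atTop (R * R))).mono fun m hm => ?_
  obtain ⟨hm, hRm⟩ := hm
  have hsub : A ∩ Set.Iic m ⊆ (Finset.range (9 * (Nat.sqrt m + 1)) : Set ℕ) := fun n hn => by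
    simpa using hm n hn.1 hn.2
  have hc := Set.ncard_le_ncard hsub (Finset.finite_toSet _)
  rw [Set.ncard_coe_finset, Finset.card_range] at hc
  have hRs : R ≤ Nat.sqrt m := Nat.le_sqrt.2 hRm
  have hsm : Nat.sqrt m * Nat.sqrt m ≤ m := Nat.sqrt_le m
  rw [div_le_iff₀ (by positivity)]
  set r := Nat.sqrt m
  have hc' : ((A ∩ Set.Iic m).ncard : ℝ) ≤ 9 * (r + 1) := by exact_mod_cast hc
  have hRs' : (R : ℝ) ≤ r := by exact_mod_cast hRs
  have hsm' : (r : ℝ) * r ≤ m := by exact_mod_cast hsm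
  have h18 : 18 ≤ δ * r := by
    have : 18 / δ ≤ r := by linarith
    rwa [div_le_iff₀' hδ] at this
  have hr1 : (1 : ℝ) ≤ r := by
    have : 0 < 18 / δ := by positivity
    linarith
  nlinarith

theorem succ_le_two_pow_sqrt (m : ℕ) : (m + 1) ^ 2 ≤ 2 ^ (4 * (Nat.sqrt m + 1)) := by
  have h1 : m + 1 ≤ (Nat.sqrt m + 1) ^ 2 := Nat.succ_le_succ_sqrt' m
  have h2 : Nat.sqrt m + 1 ≤ 2 ^ (Nat.sqrt m + 1) := Nat.lt_two_pow_self.le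
  calc (m + 1) ^ 2 ≤ ((2 ^ (Nat.sqrt m + 1)) ^ 2) ^ 2 := by gcongr; exact h1.trans (by gcongr)
    _ = _ := by rw [← pow_mul, ← pow_mul]; congr 1; ring

/-- Coordinate m - n of the iterate is x_m amplified by 2^(D(m) - D(m-n)), and 2(D(m) - D(m-n)) ≥ n
- √m - 1 ≥ 8(√m + 1). The constant 9 leaves the factor 2^(4(√m+1)) ≥ (m+1)^2 needed to offset the
size of x_m. -/
theorem one_le_norm_blockShift_pow {x : lp (fun _ : ℕ => 𝕜) p} {m n : ℕ}
    (hx : ((m + 1 : ℝ) ^ 2)⁻¹ < ‖x m‖) (hnm : n ≤ m) (hn : 9 * (Nat.sqrt m + 1) ≤ n) :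
    1 ≤ ‖(blockShift 𝕜 p ^ n) x‖ := by
  have h1 := norm_apply_le ((blockShift 𝕜 p ^ n) x) (m - n)
  refine le_trans ?_ h1
  rw [norm_blockShift_pow_apply, Nat.sub_add_cancel hnm, norm_mul, norm_pow, RCLike.norm_ofNat]
  have h2 := le_two_mul_doublings m
  have h3 := two_mul_doublings_le (m - n)
  have h4 : Nat.sqrt (m - n) ≤ Nat.sqrt m := Nat.sqrt_le_sqrt (by omega)
  have h5 : doublings (m - n) + 4 * (Nat.sqrt m + 1) ≤ doublings m := by omega
  have h6 : ((m + 1 : ℝ) ^ 2) ≤ 2 ^ (4 * (Nat.sqrt m + 1)) := by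
    exact_mod_cast succ_le_two_pow_sqrt m
  have h7 : (2 : ℝ) ^ doublings (m - n) * (m + 1 : ℝ) ^ 2 ≤ 2 ^ doublings m :=
    calc _ ≤ (2 : ℝ) ^ doublings (m - n) * 2 ^ (4 * (Nat.sqrt m + 1)) := by gcongr
      _ ≤ _ := by rw [← pow_add]; exact pow_le_pow_right₀ (by norm_num) h5
  calc (1 : ℝ) = (2 ^ doublings (m - n))⁻¹ *
        ((2 ^ doublings (m - n) * (m + 1 : ℝ) ^ 2) * ((m + 1 : ℝ) ^ 2)⁻¹) := by
        have : (m + 1 : ℝ) ≠ 0 := by positivity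
        field_simp
    _ ≤ (2 ^ doublings (m - n))⁻¹ * (2 ^ doublings m * ‖x m‖) := by gcongr

theorem not_hasFrequentlyHypercyclicSubspace_blockShift (hp : p ≠ ∞) :
    ¬ HasFrequentlyHypercyclicSubspace (blockShift 𝕜 p) := by
  rintro ⟨M, hMc, hM, hfhc⟩
  have hsum : Summable fun m : ℕ => ((m + 1 : ℝ) ^ 2)⁻¹ := by
    have := (summable_nat_add_iff 1).2 (Real.summable_nat_pow_inv (p := 2).2 (by norm_num))
    simpa using this
  obtain ⟨x, hxM, hx⟩ := exists_frequently_lt_norm_apply hp M hMc hM hsum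
  have hx0 : x ≠ 0 := by
    rintro rfl
    obtain ⟨m, hm⟩ := hx.exists
    rw [lp.coeFn_zero, Pi.zero_apply, norm_zero] at hm
    exact absurd hm (not_lt.2 (by positivity))
  refine absurd (hfhc x hxM hx0 (Metric.ball 0 1) Metric.isOpen_ball
    (Metric.nonempty_ball.2 one_pos)) (not_lt.2 (lowerDensity_nonpos_of_frequently ?_))
  refine hx.mono fun m hm n hn hnm => ?_
  by_contra! h
  have h1 : ‖(blockShift 𝕜 p ^ n) x‖ < 1 := by simpa using hn
  exact absurd h1 (not_lt.2 (one_le_norm_blockShift_pow hm hnm h))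

end NoFrequentlyHypercyclicSubspace

/-! ### A frequently hypercyclic vector. -/

section FrequentlyHypercyclic

theorem lowerDensity_pos_of_injective {A : Set ℕ} {f : ℕ → ℕ} (hf : Function.Injective f)
    (hA : ∀ u, f u ∈ A) {K : ℕ} (hK : 0 < K) (hle : ∀ u, f u ≤ K * (u + 1)) :
    0 < lowerDensity A := by
  have hK' : (0 : ℝ) < K := by exact_mod_cast hK
  have key : ∀ᶠ N : ℕ in atTop,
      1 / (2 * K : ℝ) ≤ ((A ∩ Set.Iic N).ncard : ℝ) / ((N : ℝ) + 1) := by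
    -- With c elements of A up to N, N < K(c + 1) gives 2Kc > 2N - 2K, and this is at least N + 1
    -- from this threshold on.
    filter_upwards [eventually_ge_atTop (2 * K + 1)] with N hN
    have hsub : ((Finset.range (N / K)).image f : Set ℕ) ⊆ A ∩ Set.Iic N := by
      intro n hn
      simp only [Finset.coe_image, Set.mem_image, Finset.coe_range, Set.mem_Iio] at hn
      obtain ⟨u, hu, rfl⟩ := hn
      exact ⟨hA u, (hle u).trans ((Nat.mul_le_mul_left K hu).trans (Nat.mul_div_le N K))⟩
    have hc := Set.ncard_le_ncard hsub ((Set.finite_Iic N).inter_of_right A)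
    rw [Set.ncard_coe_finset, Finset.card_image_of_injective _ hf, Finset.card_range] at hc
    have hdiv : N < K * (N / K + 1) := Nat.lt_mul_div_succ N hK
    have h1 : (N : ℝ) < K * ((A ∩ Set.Iic N).ncard + 1) := by
      calc (N : ℝ) < K * ((N / K : ℕ) + 1) := by exact_mod_cast hdiv
        _ ≤ _ := by gcongr
    have hN' : (2 * K + 1 : ℝ) ≤ N := by exact_mod_cast hN
    rw [div_le_div_iff₀ (by positivity) (by positivity)]
    nlinarith
  -- A real `liminf` is meaningful only under boundedness; here the ratios are at most 1.
  have hcob : IsCoboundedUnder (· ≥ ·) atTop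
      fun N : ℕ => ((A ∩ Set.Iic N).ncard : ℝ) / ((N : ℝ) + 1) := by
    refine IsBoundedUnder.isCoboundedUnder_ge (isBoundedUnder_of ⟨1, fun N => ?_⟩)
    have hc := Set.ncard_le_ncard (Set.inter_subset_right (s := A) (t := Set.Iic N))
      (Set.finite_Iic N)
    have hN : (Set.Iic N).ncard = N + 1 := by
      rw [← Finset.coe_Iic, Set.ncard_coe_finset, Nat.card_Iic]
    rw [hN] at hc
    exact div_le_one_of_le₀ (by exact_mod_cast hc) (by positivity)
  exact lt_of_lt_of_le (by positivity) (le_liminf_of_le hcob key)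

/-- The index of the word written in slot `t`. -/
def slotWord (t : ℕ) : ℕ := padicValNat 2 (t + 1)

/-- The starting point of slot `t`; this slot has length `2 * slotWord t + 1`. -/
def slotStart (t : ℕ) : ℕ := 2 * padicValNat 2 t.factorial + t

/-- The 2-adic valuation of t! is the sum of the earlier word indices, so slot starts have a closed
form, with linear growth by Legendre's formula. -/
theorem slotStart_succ (t : ℕ) : slotStart (t + 1) = slotStart t + (2 * slotWord t + 1) := by
  rw [slotStart, slotStart, slotWord, Nat.factorial_succ,
    padicValNat.mul (by omega) (Nat.factorial_ne_zero t)]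
  ring

theorem slotStart_strictMono : StrictMono slotStart :=
  strictMono_nat_of_lt_succ fun t => by rw [slotStart_succ]; omega

theorem slotStart_le (t : ℕ) : slotStart t ≤ 3 * t := by
  have := sub_one_mul_padicValNat_factorial (p := 2) t
  rw [slotStart]
  omega

/-- The slot containing the position `k`. -/
def slot (k : ℕ) : ℕ := Nat.findGreatest (fun t => slotStart t ≤ k) k

theorem slotStart_slot_le (k : ℕ) : slotStart (slot k) ≤ k :=
  Nat.findGreatest_spec (P := fun t => slotStart t ≤ k) (Nat.zero_le k) (by simp [slotStart])

theorem le_slot {k t : ℕ} (h : slotStart t ≤ k) : t ≤ slot k :=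
  Nat.le_findGreatest ((slotStart_strictMono.id_le t).trans h) h

theorem slot_eq {k t : ℕ} (h1 : slotStart t ≤ k) (h2 : k < slotStart (t + 1)) : slot k = t := by
  refine le_antisymm ?_ (le_slot h1)
  have := slotStart_strictMono.lt_iff_lt.1 ((slotStart_slot_le k).trans_lt h2)
  omega

variable {𝕜 : Type*} [RCLike 𝕜] {p : ℝ≥0∞} [Fact (1 ≤ p)]

/-- The concatenation of the words `word (slotWord t)`, each preceded by as many zeros as it has
letters. -/
noncomputable def concatWords (𝕜 : Type*) [RCLike 𝕜] (k : ℕ) : 𝕜 :=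
  if slotStart (slot k) + slotWord (slot k) ≤ k then
    word 𝕜 (slotWord (slot k)) (k - (slotStart (slot k) + slotWord (slot k))) else 0

theorem concatWords_add {t k : ℕ} (hk : k ≤ slotWord t) :
    concatWords 𝕜 (k + (slotStart t + slotWord t)) = word 𝕜 (slotWord t) k := by
  have h : slot (k + (slotStart t + slotWord t)) = t :=
    slot_eq (by omega) (by rw [slotStart_succ]; omega)
  rw [concatWords, h, if_pos (by omega), Nat.add_sub_cancel]

/-- This is the purpose of the leading zeros: seen from a time before its slot, a word of index j
starts at offset at least j, and j bounds its letters. -/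
theorem norm_concatWords_add_le {n k : ℕ} (h : n ≤ slotStart (slot (k + n))) :
    ‖concatWords 𝕜 (k + n)‖ ≤ k := by
  rw [concatWords]
  split_ifs with h'
  · refine (norm_word_le _ _).trans ?_
    exact_mod_cast (show slotWord (slot (k + n)) ≤ k by omega)
  · simp

theorem norm_concatWords_le (k : ℕ) : ‖concatWords 𝕜 k‖ ≤ 1 * k := by
  simpa using norm_concatWords_add_le (𝕜 := 𝕜) (n := 0) (k := k) (Nat.zero_le _)

/-- A frequently hypercyclic vector. -/
noncomputable def concatVec (𝕜 : Type*) [RCLike 𝕜] (p : ℝ≥0∞) [Fact (1 ≤ p)] :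
    lp (fun _ : ℕ => 𝕜) p :=
  ⟨fun k => ((2 : 𝕜) ^ doublings k)⁻¹ * concatWords 𝕜 k, inv_two_pow_mul_memℓp norm_concatWords_le⟩

theorem two_pow_mul_concatVec_apply (k : ℕ) :
    (2 : 𝕜) ^ doublings k * concatVec 𝕜 p k = concatWords 𝕜 k :=
  mul_inv_cancel_left₀ (pow_ne_zero _ two_ne_zero) _

theorem norm_blockShift_pow_concatVec_sub_le (hp : p ≠ ∞) (t : ℕ) :
    ‖(blockShift 𝕜 p ^ (slotStart t + slotWord t)) (concatVec 𝕜 p) - wordVec 𝕜 p (slotWord t)‖ ≤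
      decayTail (slotWord t) := by
  have := norm_blockShift_pow_sub_wordVec_le hp (x := concatVec 𝕜 p)
    (n := slotStart t + slotWord t) (s := slotWord t) (c := 1) (C := 1)
    (fun k hk => by rw [two_pow_mul_concatVec_apply, concatWords_add hk.le, one_mul])
    (fun k hk => by
      rw [two_pow_mul_concatVec_apply, one_mul]
      -- Offset s is the last position of the same slot, a zero; larger offsets lie in later slots.
      rcases hk.eq_or_lt with rfl | hk
      · rw [concatWords_add le_rfl, word_eq_zero le_rfl]
        simp
      · refine norm_concatWords_add_le ?_
        have h1 : t + 1 ≤ slot (k + (slotStart t + slotWord t)) :=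
          le_slot (by rw [slotStart_succ]; omega)
        have h2 := slotStart_strictMono.monotone h1
        rw [slotStart_succ] at h2
        omega)
  simpa using this

theorem slotWord_two_pow_mul (j u : ℕ) : slotWord (2 ^ j * (2 * u + 1) - 1) = j := by
  have h : 0 < 2 ^ j * (2 * u + 1) := by positivity
  rw [slotWord, Nat.sub_add_cancel h, padicValNat.mul (by positivity) (by omega),
    padicValNat.prime_pow, padicValNat.eq_zero_of_not_dvd (by omega), add_zero]

theorem isFrequentlyHypercyclic_blockShift (hp : p ≠ ∞) :
    IsFrequentlyHypercyclic (blockShift 𝕜 p) := by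
  refine ⟨concatVec 𝕜 p, fun U hU hne => ?_⟩
  obtain ⟨x, hx⟩ := hne
  obtain ⟨ε, hε, hball⟩ := Metric.isOpen_iff.1 hU x hx
  obtain ⟨S, hS⟩ := eventually_atTop.1
    (tendsto_decayTail.eventually_lt_const (show (0 : ℝ) < ε / 2 by positivity))
  obtain ⟨j, hjS, -, hj⟩ := exists_wordVec_near hp x (show (0 : ℝ) < ε / 2 by positivity) 0 S
  -- These are the slots t with t + 1 of 2-adic valuation j, an arithmetic progression.
  let τ : ℕ → ℕ := fun u => 2 ^ j * (2 * u + 1) - 1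
  have hpos : ∀ u, 0 < 2 ^ j * (2 * u + 1) := fun u => by positivity
  have hτ : StrictMono τ := strictMono_nat_of_lt_succ fun u => by
    have h1 : 2 ^ j * (2 * u + 1) < 2 ^ j * (2 * (u + 1) + 1) :=
      Nat.mul_lt_mul_of_pos_left (by omega) (by positivity)
    have := hpos u
    simp only [τ]
    omega
  refine lowerDensity_pos_of_injective (f := fun u => slotStart (τ u) + j)
    (K := 6 * 2 ^ j + j) ?_ (fun u => ?_) (by positivity) (fun u => ?_)
  · intro a b hab
    exact hτ.injective (slotStart_strictMono.injective (Nat.add_right_cancel hab))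
  · refine hball ?_
    have h1 := norm_blockShift_pow_concatVec_sub_le (𝕜 := 𝕜) hp (τ u)
    rw [slotWord_two_pow_mul] at h1
    rw [Metric.mem_ball, dist_eq_norm]
    have h2 := hS j hjS
    linarith [norm_sub_le_norm_sub_add_norm_sub
      ((blockShift 𝕜 p ^ (slotStart (τ u) + j)) (concatVec 𝕜 p)) (wordVec 𝕜 p j) x]
  · have h1 := slotStart_le (τ u)
    have h2 : τ u ≤ 2 ^ j * (2 * u + 1) := Nat.sub_le _ _
    show slotStart (τ u) + j ≤ _
    nlinarith [Nat.zero_le (j * u), Nat.one_le_two_pow (n := j)]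

end FrequentlyHypercyclic

/-! ### A hypercyclic subspace. -/

section HypercyclicSubspace

/-- The times at which the words are placed. -/
def wordStart : ℕ → ℕ
  | 0 => 1
  | s + 1 => (wordStart s + s) * (wordStart s + s + 1) + s + 2

/-- The free coordinates; `pivot s` is the last position of a block of `wordStart s + s` weights
equal to `1`. -/
def pivot (s : ℕ) : ℕ := (wordStart s + s) * (wordStart s + s + 1)

theorem wordStart_succ (s : ℕ) : wordStart (s + 1) = pivot s + s + 2 := rfl

theorem lt_wordStart (s : ℕ) : s < wordStart s := by
  cases s with
  | zero => simp [wordStart]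
  | succ s => rw [wordStart_succ]; omega

theorem wordStart_add_lt_pivot (s : ℕ) : wordStart s + s < pivot s := by
  have := lt_wordStart s
  rw [pivot]
  nlinarith

theorem wordStart_strictMono : StrictMono wordStart :=
  strictMono_nat_of_lt_succ fun s => by
    have := wordStart_add_lt_pivot s
    rw [wordStart_succ]; omega

/-- Word s is followed by pivot s, then by a gap exceeding the next index. Hence, at the start of an
earlier word, the letters of word t are met only at offsets above t, which bounds them. -/
theorem pivot_add_lt_wordStart {s t : ℕ} (h : s < t) : pivot s + t < wordStart t := by
  obtain ⟨u, rfl⟩ : ∃ u, t = u + 1 := ⟨t - 1, by omega⟩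
  have h1 : pivot s ≤ pivot u := by
    have := wordStart_strictMono.monotone (show s ≤ u by omega)
    exact Nat.mul_le_mul (by omega) (by omega)
  rw [wordStart_succ]
  omega

theorem pivot_strictMono : StrictMono pivot := fun s t h => by
  have h1 := pivot_add_lt_wordStart h
  have h2 := wordStart_add_lt_pivot t
  omega

theorem pivot_ne_of_lt {s k : ℕ} (hk : k < s) (t : ℕ) : pivot t ≠ k + wordStart s := by
  rcases lt_or_ge t s with h | h
  · have := pivot_add_lt_wordStart h
    omega
  · have h1 := wordStart_strictMono.monotone h
    have h2 := wordStart_add_lt_pivot t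
    omega

/-- The run of ones ending at the pivot has length at least `wordStart s`, so shifting that far does
not amplify the pivot coordinate. -/
theorem doublings_pivot_sub {s q : ℕ} (hq : q ≤ wordStart s) :
    doublings (pivot s - q) = doublings (pivot s) :=
  doublings_eq_of_le (by omega)

/-- The index of the last word starting at or before `q`. -/
def wordIndex (q : ℕ) : ℕ := Nat.findGreatest (fun t => wordStart t ≤ q) q

theorem wordIndex_eq {s k : ℕ} (hk : k + wordStart s < wordStart (s + 1)) :
    wordIndex (k + wordStart s) = s := by
  refine le_antisymm ?_ (Nat.le_findGreatest (by have := lt_wordStart s; omega) (by omega))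
  by_contra! h
  have h1 := Nat.findGreatest_of_ne_zero (P := fun t => wordStart t ≤ k + wordStart s)
    (m := wordIndex (k + wordStart s)) rfl (by omega)
  have h2 := wordStart_strictMono.monotone (show s + 1 ≤ wordIndex (k + wordStart s) by omega)
  omega

variable {𝕜 : Type*} [RCLike 𝕜] {p : ℝ≥0∞} [Fact (1 ≤ p)]

/-- The concatenation of the words with tag `i`, the word `s` being placed at `wordStart s`. -/
noncomputable def taggedWords (𝕜 : Type*) [RCLike 𝕜] (i q : ℕ) : 𝕜 :=
  if wordTag (wordIndex q) = i ∧ wordStart (wordIndex q) ≤ q then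
    word 𝕜 (wordIndex q) (q - wordStart (wordIndex q)) else 0

theorem taggedWords_add {i s k : ℕ} (hk : k + wordStart s < wordStart (s + 1)) :
    taggedWords 𝕜 i (k + wordStart s) = if wordTag s = i then word 𝕜 s k else 0 := by
  rw [taggedWords, wordIndex_eq hk, Nat.add_sub_cancel]
  simp

theorem taggedWords_pivot (i s : ℕ) : taggedWords 𝕜 i (pivot s) = 0 := by
  have h1 := wordStart_add_lt_pivot s
  have h2 := wordStart_succ s
  obtain ⟨k, hk⟩ : ∃ k, pivot s = k + wordStart s := ⟨pivot s - wordStart s, by omega⟩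
  rw [hk, taggedWords_add (by omega), word_eq_zero (by omega), ite_self]

theorem taggedWords_eq_zero {i q : ℕ} (hq : ∀ s k, k < s → q ≠ k + wordStart s) :
    taggedWords 𝕜 i q = 0 := by
  rw [taggedWords]
  split_ifs with h
  · refine word_eq_zero ?_
    by_contra! h'
    exact hq _ _ h' (by omega)
  · rfl

theorem norm_taggedWords_le (i q : ℕ) : ‖taggedWords 𝕜 i q‖ ≤ 1 * q := by
  rw [taggedWords, one_mul]
  split_ifs with h
  · refine (norm_word_le _ _).trans ?_
    exact_mod_cast ((lt_wordStart _).le.trans h.2)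
  · simp

/-- A basis vector of the hypercyclic subspace: a perturbation of a canonical basis vector. -/
noncomputable def taggedVec (𝕜 : Type*) [RCLike 𝕜] (p : ℝ≥0∞) [Fact (1 ≤ p)] (i : ℕ) :
    lp (fun _ : ℕ => 𝕜) p :=
  lp.single p (pivot i) 1 + ⟨fun q => ((2 : 𝕜) ^ doublings q)⁻¹ * taggedWords 𝕜 i q,
    inv_two_pow_mul_memℓp (norm_taggedWords_le i)⟩

theorem taggedVec_apply (i q : ℕ) : taggedVec 𝕜 p i q =
    (if q = pivot i then 1 else 0) + ((2 : 𝕜) ^ doublings q)⁻¹ * taggedWords 𝕜 i q := by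
  rw [taggedVec, lp.coeFn_add, Pi.add_apply, lp.single_apply, Pi.single_apply]

theorem taggedVec_pivot (i j : ℕ) : taggedVec 𝕜 p i (pivot j) = if j = i then 1 else 0 := by
  rw [taggedVec_apply, taggedWords_pivot, mul_zero, add_zero]
  simp only [pivot_strictMono.injective.eq_iff]

/-- The sequences determined by their values at the pivots, the word `s` being placed at
`wordStart s` with coefficient the value at the pivot given by its tag. -/
noncomputable def taggedSubspace (𝕜 : Type*) [RCLike 𝕜] (p : ℝ≥0∞) [Fact (1 ≤ p)] :
    Submodule 𝕜 (lp (fun _ : ℕ => 𝕜) p) where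
  carrier := {x | (∀ s k, k < s → (2 : 𝕜) ^ doublings (k + wordStart s) * x (k + wordStart s) =
      x (pivot (wordTag s)) * word 𝕜 s k) ∧
    ∀ q, (∀ s, q ≠ pivot s) → (∀ s k, k < s → q ≠ k + wordStart s) → x q = 0}
  add_mem' := by
    rintro x y ⟨hx1, hx2⟩ ⟨hy1, hy2⟩
    simp only [Set.mem_ofPred_eq, lp.coeFn_add, Pi.add_apply, mul_add, add_mul]
    exact ⟨fun s k hk => by rw [hx1 s k hk, hy1 s k hk],
      fun q h1 h2 => by rw [hx2 q h1 h2, hy2 q h1 h2, add_zero]⟩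
  zero_mem' := by simp
  smul_mem' := by
    rintro c x ⟨hx1, hx2⟩
    simp only [Set.mem_ofPred_eq, lp.coeFn_smul, Pi.smul_apply, smul_eq_mul]
    exact ⟨fun s k hk => by rw [mul_left_comm, hx1 s k hk, mul_assoc],
      fun q h1 h2 => by rw [hx2 q h1 h2, mul_zero]⟩

theorem mem_taggedSubspace {x : lp (fun _ : ℕ => 𝕜) p} : x ∈ taggedSubspace 𝕜 p ↔
    (∀ s k, k < s → (2 : 𝕜) ^ doublings (k + wordStart s) * x (k + wordStart s) =
      x (pivot (wordTag s)) * word 𝕜 s k) ∧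
    ∀ q, (∀ s, q ≠ pivot s) → (∀ s k, k < s → q ≠ k + wordStart s) → x q = 0 := Iff.rfl

theorem isClosed_taggedSubspace :
    IsClosed (taggedSubspace 𝕜 p : Set (lp (fun _ : ℕ => 𝕜) p)) := by
  have h : (taggedSubspace 𝕜 p : Set (lp (fun _ : ℕ => 𝕜) p)) =
      (⋂ (s) (k) (_ : k < s), {x : lp (fun _ : ℕ => 𝕜) p |
        (2 : 𝕜) ^ doublings (k + wordStart s) * x (k + wordStart s) =
          x (pivot (wordTag s)) * word 𝕜 s k}) ∩
      ⋂ (q) (_ : ∀ s, q ≠ pivot s) (_ : ∀ s k, k < s → q ≠ k + wordStart s),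
        {x : lp (fun _ : ℕ => 𝕜) p | x q = 0} := by
    ext x
    simp only [SetLike.mem_coe, mem_taggedSubspace, Set.mem_inter_iff, Set.mem_iInter,
      Set.mem_ofPred_eq]
  rw [h]
  refine IsClosed.inter ?_ ?_
  · exact isClosed_iInter fun s => isClosed_iInter fun k => isClosed_iInter fun _ =>
      isClosed_eq (continuous_const.mul (continuous_apply_lp _))
        ((continuous_apply_lp _).mul continuous_const)
  · exact isClosed_iInter fun q => isClosed_iInter fun _ => isClosed_iInter fun _ =>
      isClosed_eq (continuous_apply_lp _) continuous_const

theorem taggedVec_mem (i : ℕ) : taggedVec 𝕜 p i ∈ taggedSubspace 𝕜 p := by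
  refine mem_taggedSubspace.2 ⟨fun s k hk => ?_, fun q h1 h2 => ?_⟩
  · have hlt : k + wordStart s < wordStart (s + 1) := by
      have := wordStart_add_lt_pivot s
      rw [wordStart_succ]; omega
    rw [taggedVec_pivot, taggedVec_apply, if_neg (pivot_ne_of_lt hk i).symm, zero_add,
      mul_inv_cancel_left₀ (pow_ne_zero _ two_ne_zero), taggedWords_add hlt]
    split_ifs <;> simp
  · rw [taggedVec_apply, if_neg (h1 i), taggedWords_eq_zero h2, mul_zero, add_zero]

/-- Evaluations at the pivots are biorthogonal to the tagged vectors. -/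
theorem not_finiteDimensional_taggedSubspace : ¬ FiniteDimensional 𝕜 (taggedSubspace 𝕜 p) := by
  intro hfin
  have hli : LinearIndependent 𝕜 fun i => (⟨taggedVec 𝕜 p i, taggedVec_mem i⟩ :
      taggedSubspace 𝕜 p) := by
    rw [linearIndependent_iff']
    intro s g hg j hj
    let L : taggedSubspace 𝕜 p →ₗ[𝕜] 𝕜 :=
      { toFun := fun x => (x : lp (fun _ : ℕ => 𝕜) p) (pivot j)
        map_add' := fun x y => rfl
        map_smul' := fun c x => rfl }
    have hL : ∀ i, L ⟨taggedVec 𝕜 p i, taggedVec_mem i⟩ = if j = i then 1 else 0 :=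
      fun i => taggedVec_pivot i j
    have h1 := congrArg L hg
    rw [map_sum, map_zero] at h1
    simpa only [map_smul, hL, smul_eq_mul, mul_ite, mul_one, mul_zero, Finset.sum_ite_eq, hj,
      if_true] using h1
  have := hli.finite
  exact not_finite ℕ

theorem exists_pivot_ne_zero {x : lp (fun _ : ℕ => 𝕜) p} (hx : x ∈ taggedSubspace 𝕜 p)
    (hx0 : x ≠ 0) : ∃ i, x (pivot i) ≠ 0 := by
  by_contra! h
  refine hx0 (lp.ext (funext fun q => ?_))
  rw [lp.coeFn_zero, Pi.zero_apply]
  by_cases h1 : ∀ s, q ≠ pivot s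
  · by_cases h2 : ∀ s k, k < s → q ≠ k + wordStart s
    · exact hx.2 q h1 h2
    · push Not at h2
      obtain ⟨s, k, hk, rfl⟩ := h2
      have := hx.1 s k hk
      rw [h, zero_mul] at this
      exact (mul_eq_zero.1 this).resolve_left (pow_ne_zero _ two_ne_zero)
  · push Not at h1
    obtain ⟨s, rfl⟩ := h1
    exact h s

open Classical in
/-- The restriction of a sequence to the pivots of index at least `s`. -/
noncomputable def pivotPart (hp : p ≠ ∞) (x : lp (fun _ : ℕ => 𝕜) p) (s : ℕ) :
    lp (fun _ : ℕ => 𝕜) p :=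
  ⟨fun q => if ∃ t ≥ s, q = pivot t then x q else 0, by
    have hp0 : 0 < p.toReal := ENNReal.toReal_pos (zero_lt_one.trans_le Fact.out).ne' hp
    refine memℓp_gen (((lp.memℓp x).summable hp0).of_nonneg_of_le (fun q => by positivity)
      fun q => ?_)
    gcongr
    split_ifs <;> simp⟩

open Classical in
theorem pivotPart_apply (hp : p ≠ ∞) (x : lp (fun _ : ℕ => 𝕜) p) (s q : ℕ) :
    pivotPart hp x s q = if ∃ t ≥ s, q = pivot t then x q else 0 := rfl

/-- Every pivot of index at least s ends a run of ones longer than the shift applied, so the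
coordinates are only translated. -/
theorem norm_blockShift_pow_pivotPart_le (hp : p ≠ ∞) (x : lp (fun _ : ℕ => 𝕜) p) (s : ℕ) :
    ‖(blockShift 𝕜 p ^ wordStart s) (pivotPart hp x s)‖ ≤ ‖tailPart x s‖ := by
  refine norm_le_of_norm_le_add hp (wordStart s) fun k => ?_
  have hs := lt_wordStart s
  rw [norm_blockShift_pow_apply, tailPart_apply, if_neg (by omega), pivotPart_apply]
  split_ifs with h
  · obtain ⟨t, ht, hkt⟩ := h
    have h1 : doublings (k + wordStart s) = doublings k := by
      rw [hkt, ← doublings_pivot_sub (wordStart_strictMono.monotone ht), ← hkt, Nat.add_sub_cancel]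
    rw [h1, norm_mul, norm_pow, RCLike.norm_ofNat, inv_mul_cancel_left₀ (by positivity)]
  · simp

/-- Pivots of index below s have been shifted away, later pivots contribute a tail of x, and later
words contribute a decaying sum. -/
theorem norm_blockShift_pow_wordStart_sub_le (hp : p ≠ ∞) {x : lp (fun _ : ℕ => 𝕜) p}
    (hx : x ∈ taggedSubspace 𝕜 p) (s : ℕ) :
    ‖(blockShift 𝕜 p ^ wordStart s) x - x (pivot (wordTag s)) • wordVec 𝕜 p s‖ ≤
      ‖tailPart x s‖ + ‖x‖ * decayTail s := by
  have h1 := norm_blockShift_pow_pivotPart_le hp x s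
  have happ : ∀ q, (x - pivotPart hp x s) q = x q - pivotPart hp x s q := fun q => rfl
  have h2 := norm_blockShift_pow_sub_wordVec_le hp (x := x - pivotPart hp x s)
    (n := wordStart s) (s := s) (c := x (pivot (wordTag s))) (C := ‖x‖)
    (fun k hk => by
      rw [happ, pivotPart_apply, if_neg, sub_zero, hx.1 s k hk]
      rintro ⟨t, -, ht⟩
      exact pivot_ne_of_lt hk t ht.symm)
    (fun k hk => by
      rw [happ, pivotPart_apply]
      split_ifs with h
      · rw [sub_self, mul_zero, norm_zero]; positivity
      · rw [sub_zero]
        by_cases hw : ∀ t l, l < t → k + wordStart s ≠ l + wordStart t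
        · have hq : ∀ t, k + wordStart s ≠ pivot t := by
            intro t ht
            have hts : t < s := by
              by_contra! hst
              exact h ⟨t, hst, ht⟩
            have := pivot_add_lt_wordStart hts
            omega
          rw [hx.2 _ hq hw, mul_zero, norm_zero]; positivity
        · push Not at hw
          obtain ⟨t, l, hl, hkl⟩ := hw
          -- A word placed earlier ends before `wordStart s`, and word s itself has only s letters,
          -- while k ≥ s.
          have hst : s < t := by
            by_contra! hts
            rcases hts.eq_or_lt with rfl | hts
            · omega
            · have h3 := pivot_add_lt_wordStart hts
              have h4 := wordStart_add_lt_pivot t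
              omega
          have htk : t ≤ k := by
            have h3 := pivot_add_lt_wordStart hst
            have h4 := wordStart_add_lt_pivot s
            omega
          rw [hkl, hx.1 t l hl, norm_mul]
          have h5 : ‖word 𝕜 t l‖ ≤ k := (norm_word_le t l).trans (by exact_mod_cast htk)
          gcongr
          exact norm_apply_le x _)
  have h3 : (blockShift 𝕜 p ^ wordStart s) x - x (pivot (wordTag s)) • wordVec 𝕜 p s =
      (blockShift 𝕜 p ^ wordStart s) (pivotPart hp x s) +
        ((blockShift 𝕜 p ^ wordStart s) (x - pivotPart hp x s) -
          x (pivot (wordTag s)) • wordVec 𝕜 p s) := by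
    rw [map_sub]; abel
  rw [h3]
  exact (norm_add_le _ _).trans (add_le_add h1 h2)

theorem isHypercyclicVector_of_mem_taggedSubspace (hp : p ≠ ∞) {x : lp (fun _ : ℕ => 𝕜) p}
    (hx : x ∈ taggedSubspace 𝕜 p) (hx0 : x ≠ 0) : IsHypercyclicVector (blockShift 𝕜 p) x := by
  obtain ⟨i, hi⟩ := exists_pivot_ne_zero hx hx0
  refine Metric.dense_iff.2 fun y ε hε => ?_
  have hlim : Tendsto (fun s => ‖tailPart x s‖ + ‖x‖ * decayTail s) atTop (𝓝 0) := by
    simpa using (tendsto_tailPart hp x).add (tendsto_decayTail.const_mul ‖x‖)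
  obtain ⟨S, hS⟩ := eventually_atTop.1
    (hlim.eventually_lt_const (show (0 : ℝ) < ε / 2 by positivity))
  have hi' : 0 < ‖x (pivot i)‖ := norm_pos_iff.2 hi
  -- Words with tag i enter x multiplied by `x (pivot i)`, so the target is divided by that scalar
  -- and the tolerance by its norm.
  obtain ⟨s, hsS, hsi, hs⟩ := exists_wordVec_near hp ((x (pivot i))⁻¹ • y)
    (show (0 : ℝ) < ε / 2 / ‖x (pivot i)‖ by positivity) i S
  refine ⟨_, ?_, wordStart s, rfl⟩
  have h1 := norm_blockShift_pow_wordStart_sub_le hp hx s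
  rw [hsi] at h1
  have h2 := hS s hsS
  have h3 : ‖x (pivot i) • wordVec 𝕜 p s - y‖ < ε / 2 := by
    have : x (pivot i) • wordVec 𝕜 p s - y =
        x (pivot i) • (wordVec 𝕜 p s - (x (pivot i))⁻¹ • y) := by
      rw [smul_sub, smul_inv_smul₀ hi]
    rw [this, norm_smul]
    rwa [lt_div_iff₀' hi'] at hs
  rw [Metric.mem_ball, dist_eq_norm]
  linarith [norm_sub_le_norm_sub_add_norm_sub ((blockShift 𝕜 p ^ wordStart s) x)
    (x (pivot i) • wordVec 𝕜 p s) y]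

theorem hasHypercyclicSubspace_blockShift (hp : p ≠ ∞) :
    HasHypercyclicSubspace (blockShift 𝕜 p) :=
  ⟨taggedSubspace 𝕜 p, isClosed_taggedSubspace, not_finiteDimensional_taggedSubspace,
    fun _ hx hx0 => isHypercyclicVector_of_mem_taggedSubspace hp hx hx0⟩

end HypercyclicSubspace

end LinearDynamics

theorem theorem2p5 (𝕜 : Type*) [RCLike 𝕜] (p : ℝ≥0∞) [Fact (1 ≤ p)] (hp : p ≠ ∞) :
    ∃ (w : ℕ → 𝕜) (hw : LinearDynamics.IsWeightSequence w),
      (∀ k : ℕ, 1 ≤ k → (∃ n : ℕ, 1 + n * (n + 1) ≤ k ∧ k < 1 + (n + 1) ^ 2) → w k = 2) ∧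
      (∀ k : ℕ, 1 ≤ k → (¬ ∃ n : ℕ, 1 + n * (n + 1) ≤ k ∧ k < 1 + (n + 1) ^ 2) → w k = 1) ∧
      LinearDynamics.IsFrequentlyHypercyclic (LinearDynamics.weightedShift p w hw) ∧
      LinearDynamics.HasHypercyclicSubspace (LinearDynamics.weightedShift p w hw) ∧
      ¬ LinearDynamics.HasFrequentlyHypercyclicSubspace
          (LinearDynamics.weightedShift p w hw) :=
  ⟨LinearDynamics.blockWeight 𝕜, LinearDynamics.isWeightSequence_blockWeight,
    fun _ _ h => if_pos h, fun _ _ h => if_neg h,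
    LinearDynamics.isFrequentlyHypercyclic_blockShift hp,
    LinearDynamics.hasHypercyclicSubspace_blockShift hp,
    LinearDynamics.not_hasFrequentlyHypercyclicSubspace_blockShift hp⟩
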